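/- Let $\mathcal H$ be a complex Hilbert space and $T$ a bounded linear operator on $\mathcal H$. Write $|T|=(T^*T)^{1/2}$, $|T^*|=(TT^*)^{1/2}$, $\mathcal R T=\frac{T+T^*}{2}$, and let $\le$ be the Löwner order (that is, $A\le B$ if $B-A$ is positive semi-definite). For positive invertible operators $A,B$ put $$A\,\sharp\, B=A^{1/2}\bigl(A^{-1/2}BA^{-1/2}\bigr)^{1/2}A^{1/2},$$ and for positive semi-definite, not necessarily invertible $A,B$ let $A\,\sharp\, B$ be the limit, in the strong operator topology, of $(A+\varepsilon I)\,\sharp\,(B+\varepsilon I)$ as $\varepsilon\downarrow 0$. Let $0<\alpha\le 1\le\beta$ be real numbers and suppose that $T$ is $(\alpha,\beta)$-normal, that is, $$\alpha^2|T|^2\le |T^*|^2\le \beta^2|T|^2 .$$ Then the geometric mean $|T|\,\sharp\,|T^*|$ exists (the limit above exists), and $$\pm\,\mathcal R T\le \sqrt[4]{\frac{\beta}{\alpha}}\;\bigl(|T|\,\sharp\,|T^*|\bigr).$$ -/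

import Mathlib

open Filter Topology

noncomputable section

variable {H : Type*} [NormedAddCommGroup H] [InnerProductSpace ℂ H] [CompleteSpace H]

/-- `T` is `(α, β)`-normal: `0 ≤ α ≤ 1 ≤ β` and `α² |T|² ≤ |T*|² ≤ β² |T|²` in the Löwner order.
Here `CFC.abs T` is `|T|`, the positive square root of `T* T`. -/
structure IsAlphaBetaNormal (α β : ℝ) (T : H →L[ℂ] H) : Prop where
  alpha_nonneg : 0 ≤ α
  alpha_le_one : α ≤ 1
  one_le_beta : 1 ≤ β
  lower : α ^ 2 • CFC.abs T ^ 2 ≤ CFC.abs (star T) ^ 2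
  upper : CFC.abs (star T) ^ 2 ≤ β ^ 2 • CFC.abs T ^ 2

/-- The formula `A^{1/2} (A^{-1/2} B A^{-1/2})^{1/2} A^{1/2}` for the geometric mean; the powers are
given by the continuous functional calculus. It is meaningful for invertible `A ≥ 0` and `B ≥ 0`. -/
def geometricMeanFormula (A B : H →L[ℂ] H) : H →L[ℂ] H :=
  A ^ (1 / 2 : ℝ) * (A ^ (-(1 / 2) : ℝ) * B * A ^ (-(1 / 2) : ℝ)) ^ (1 / 2 : ℝ) * A ^ (1 / 2 : ℝ)

/-- `G` is the geometric mean of the positive, not necessarily invertible, operators `A` and `B`: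
the limit, in the strong operator topology, of the geometric means of the invertible operators
`A + ε` and `B + ε` as `ε ↓ 0`. -/
def IsGeometricMean (A B G : H →L[ℂ] H) : Prop :=
  ∀ x : H, Tendsto
    (fun ε : ℝ => geometricMeanFormula (A + ε • (1 : H →L[ℂ] H)) (B + ε • (1 : H →L[ℂ] H)) x)
    (𝓝[>] 0) (𝓝 (G x))

open Classical in
/-- The geometric mean `A ♯ B`: the strong limit above (which is unique), and `0` if there is
no such limit. -/
def geometricMean (A B : H →L[ℂ] H) : H →L[ℂ] H :=
  if h : ∃ G, IsGeometricMean A B G then h.choose else 0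

end

/-!
Write `A = |T|` and `B = |T⋆|`, and let `a = √α`, `b = √β`. Operator monotonicity of the square root
turns the normality assumption into `a² A ≤ B ≤ b² A`.

The proof sandwiches the arithmetic combination `u A + u⁻¹ B` with `u = √(a b)`. On one side,
`T + T⋆ ≤ u A + u⁻¹ B` for every `u > 0` (`add_star_le`); this follows by completing a square from
`T A⁻¹ T⋆ ≤ B`, a consequence of the intertwining relation `B T = T A`. On the other side,
`a b A + B ≤ 2 b (A ♯ B)` (`smul_add_le_geometricMeanFormula`), which reduces to
`0 ≤ (s - a)(b - s) + (b - a) s` for `s ∈ [a, b]` by the functional calculus. Dividing by `u`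
gives `T + T⋆ ≤ 2 √(b / a) (A ♯ B)`, and `√(b / a) = (β / α)^{1/4}`. The other sign is the same
statement for `-T`.

All of this is done for `A + ε` and `B + ε`, which satisfy the same two-sided bound because
`a ≤ 1 ≤ b`, and passes to the strong limit as `ε ↓ 0`. The limit exists because the geometric mean
is jointly monotone (`geometricMeanFormula_mono`) and a decreasing family of positive operators
converges strongly (`exists_strong_limit_of_monotoneOn`).
-/

/-! ### The mixed Schwarz inequality in a C⋆-algebra -/

section CStarAlgebra

variable {R : Type*} [CStarAlgebra R] [PartialOrder R] [StarOrderedRing R]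

/-- An element intertwining the squares of two positive elements intertwines the elements
themselves. The defect `x = t a - b t` satisfies `b x = -x a`, which makes `x⋆ x` commute with `a`
and `x⋆ x a = -x⋆ b x` both nonnegative and nonpositive; hence `x a = 0 = x⋆ b`, and `x = 0`. -/
lemma mul_eq_mul_of_sq_intertwine {a b t : R} (ha : 0 ≤ a) (hb : 0 ≤ b)
    (h : b * b * t = t * (a * a)) : b * t = t * a := by
  have has : star a = a := ha.isSelfAdjoint
  have hbs : star b = b := hb.isSelfAdjoint
  set x := t * a - b * t with hx
  have hbx : b * x = -(x * a) := by
    rw [hx, mul_sub, sub_mul, ← mul_assoc b b t, h]; noncomm_ring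
  have hbx' : star x * b = -(a * star x) := by
    have := congrArg star hbx
    simpa [has, hbs] using this
  have hneg : star x * b * x = -(star x * x * a) := by
    rw [mul_assoc, hbx]; noncomm_ring
  have hcomm : Commute (star x * x) a := by
    have h2 : star x * b * x = -(a * (star x * x)) := by
      rw [hbx']; noncomm_ring
    exact neg_injective (hneg.symm.trans h2)
  have hxa : star x * x * a = 0 := by
    refine le_antisymm ?_ (hcomm.mul_nonneg (star_mul_self_nonneg x) ha)
    have := star_left_conjugate_nonneg hb x
    rw [hneg] at this
    exact neg_nonneg.mp this
  have hxa0 : x * a = 0 := by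
    rw [← CStarRing.star_mul_self_eq_zero_iff, star_mul, has, mul_assoc a, ← mul_assoc (star x), hxa,
      mul_zero]
  have hax0 : a * star x = 0 := by
    simpa [has] using congrArg star hxa0
  have hxb0 : star x * b = 0 := by rw [hbx', hax0, neg_zero]
  have hxx : star x * x = star x * t * a := by
    rw [hx, mul_sub, ← hx, ← mul_assoc, ← mul_assoc, hxb0, zero_mul, sub_zero]
  -- The C⋆-identity is applied twice, since only `(x⋆ x)²` is visibly zero.
  have hz : x = 0 := by
    rw [← CStarRing.star_mul_self_eq_zero_iff, ← CStarRing.star_mul_self_eq_zero_iff, star_mul,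
      star_star]
    calc star x * x * (star x * x) = star x * t * (a * star x) * x := by
          nth_rw 1 [hxx]; simp only [mul_assoc]
      _ = 0 := by rw [hax0]; simp
  exact (sub_eq_zero.mp hz).symm

/-- The relation `|t⋆| t = t |t|`, which takes the place of the polar decomposition. -/
lemma abs_star_mul (t : R) : CFC.abs (star t) * t = t * CFC.abs t := by
  apply mul_eq_mul_of_sq_intertwine (CFC.abs_nonneg _) (CFC.abs_nonneg _)
  rw [CFC.abs_mul_abs, CFC.abs_mul_abs, star_star, mul_assoc]

lemma isStrictlyPositive_add_smul_one {a : R} (ha : 0 ≤ a) {ε : ℝ} (hε : 0 < ε) :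
    IsStrictlyPositive (a + ε • (1 : R)) :=
  (isStrictlyPositive_one.smul hε).nonneg_add ha

/-- By intertwining, the left side is `(|t⋆| + ε)⁻¹ |t⋆|²`. -/
lemma mul_ringInverse_mul_star_le (t : R) {ε : ℝ} (hε : 0 < ε) :
    t * Ring.inverse (CFC.abs t + ε • (1 : R)) * star t ≤ CFC.abs (star t) := by
  have hb := CFC.abs_nonneg (star t)
  have hbt := abs_star_mul t
  have hbb : CFC.abs (star t) * CFC.abs (star t) = t * star t := by simp [CFC.abs_mul_abs]
  set a := CFC.abs t
  set b := CFC.abs (star t)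
  set p := a + ε • (1 : R) with hp
  set q := b + ε • (1 : R) with hq
  have hpp : IsStrictlyPositive p := isStrictlyPositive_add_smul_one (CFC.abs_nonneg _) hε
  have hqp : IsStrictlyPositive q := isStrictlyPositive_add_smul_one hb hε
  have hqt : q * t = t * p := by simp [hp, hq, add_mul, mul_add, hbt]
  have hinv : t * Ring.inverse p = Ring.inverse q * t := by
    calc t * Ring.inverse p = Ring.inverse q * (q * t) * Ring.inverse p := by
          rw [← mul_assoc, Ring.inverse_mul_cancel _ hqp.isUnit, one_mul]
      _ = Ring.inverse q * t := by
          rw [hqt, mul_assoc, mul_assoc, Ring.mul_inverse_cancel _ hpp.isUnit, mul_one]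
  have hcomm : Commute (Ring.inverse q) b := by
    have hqb : q * b = b * q := by simp [hq, add_mul, mul_add]
    calc Ring.inverse q * b = Ring.inverse q * (b * q) * Ring.inverse q := by
          rw [mul_assoc, mul_assoc b, Ring.mul_inverse_cancel _ hqp.isUnit, mul_one]
      _ = b * Ring.inverse q := by
          rw [← hqb, ← mul_assoc, Ring.inverse_mul_cancel _ hqp.isUnit, one_mul]
  have hpos : 0 ≤ ε • (Ring.inverse q * b) :=
    smul_nonneg hε.le (hcomm.mul_nonneg hqp.ringInverse.nonneg hb)
  have : b - t * Ring.inverse p * star t = ε • (Ring.inverse q * b) := by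
    rw [hinv, mul_assoc, ← hbb]
    calc b - Ring.inverse q * (b * b) = Ring.inverse q * q * b - Ring.inverse q * (b * b) := by
          rw [Ring.inverse_mul_cancel _ hqp.isUnit, one_mul]
      _ = _ := by rw [hq]; simp [mul_add, add_mul, mul_assoc]
  rwa [← sub_nonneg, this]

/-- The mixed Schwarz inequality `2 Re ⟨t x, x⟩ ≤ u ⟨|t| x, x⟩ + u⁻¹ ⟨|t⋆| x, x⟩`, with `|t|` made
invertible by adding `ε`. -/
lemma add_star_le (t : R) {ε u : ℝ} (hε : 0 < ε) (hu : 0 < u) :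
    t + star t ≤ u • (CFC.abs t + ε • (1 : R)) + u⁻¹ • CFC.abs (star t) := by
  have h1 := mul_ringInverse_mul_star_le t hε
  have hpp : IsStrictlyPositive (CFC.abs t + ε • (1 : R)) :=
    isStrictlyPositive_add_smul_one (CFC.abs_nonneg _) hε
  set p := CFC.abs t + ε • (1 : R)
  have hps : star p = p := hpp.isSelfAdjoint
  -- Completing the square: with `p = |t| + ε`, expand `u⁻¹ (u p - t) p⁻¹ (u p - t)⋆ ≥ 0`.
  have h2 := smul_nonneg (inv_nonneg.mpr hu.le)
    (star_right_conjugate_nonneg hpp.ringInverse.nonneg (u • p - t))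
  have h3 : u⁻¹ • ((u • p - t) * Ring.inverse p * star (u • p - t))
      = u • p - (t + star t) + u⁻¹ • (t * Ring.inverse p * star t) := by
    have e1 : p * Ring.inverse p = 1 := Ring.mul_inverse_cancel _ hpp.isUnit
    have e2 : t * Ring.inverse p * p = t := by
      rw [mul_assoc, Ring.inverse_mul_cancel _ hpp.isUnit, mul_one]
    simp only [star_sub, star_smul, hps, sub_mul, mul_sub, smul_mul_assoc, mul_smul_comm, e1, e2,
      one_mul, star_trivial, smul_sub, smul_smul, inv_mul_cancel₀ hu.ne', one_smul]
    rw [inv_mul_cancel_left₀ hu.ne']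
    abel
  rw [h3] at h2
  have h4 := smul_le_smul_of_nonneg_left h1 (inv_nonneg.mpr hu.le)
  calc t + star t ≤ u • p + u⁻¹ • (t * Ring.inverse p * star t) := by
        rw [← sub_nonneg]; convert h2 using 1; abel
    _ ≤ _ := by gcongr

end CStarAlgebra

section Operators

variable {H : Type*} [NormedAddCommGroup H] [InnerProductSpace ℂ H] [CompleteSpace H]

/-! ### The geometric mean of invertible operators -/

lemma rpow_half_mul_rpow_half {A : H →L[ℂ] H} (hA : 0 ≤ A) :
    A ^ (1 / 2 : ℝ) * A ^ (1 / 2 : ℝ) = A := by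
  rw [← CFC.sqrt_eq_rpow, CFC.sqrt_mul_sqrt_self A hA]

lemma rpow_neg_half_mul_rpow_neg_half {A : H →L[ℂ] H} (hA : IsStrictlyPositive A) :
    A ^ (-(1 / 2) : ℝ) * A ^ (-(1 / 2) : ℝ) = A ^ (-1 : ℝ) := by
  rw [← CFC.rpow_add hA.isUnit]; norm_num

lemma conj_nonneg_of_nonneg {P X : H →L[ℂ] H} (hP : 0 ≤ P) (hX : 0 ≤ X) : 0 ≤ P * X * P :=
  hP.isSelfAdjoint.conjugate_nonneg hX

lemma conj_le_conj_of_nonneg {P X Y : H →L[ℂ] H} (hP : 0 ≤ P) (hXY : X ≤ Y) :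
    P * X * P ≤ P * Y * P :=
  hP.isSelfAdjoint.conjugate_le_conjugate hXY

lemma geometricMeanFormula_nonneg (A B : H →L[ℂ] H) : 0 ≤ geometricMeanFormula A B :=
  conj_nonneg_of_nonneg CFC.rpow_nonneg CFC.rpow_nonneg

/-- The geometric mean `G` of `A` and `B` solves the Riccati equation `G A⁻¹ G = B`. -/
lemma geometricMeanFormula_riccati {A B : H →L[ℂ] H} (hA : IsStrictlyPositive A) (hB : 0 ≤ B) :
    geometricMeanFormula A B * A ^ (-1 : ℝ) * geometricMeanFormula A B = B := by
  have hPQ : A ^ (1 / 2 : ℝ) * A ^ (-(1 / 2) : ℝ) = 1 := CFC.rpow_mul_rpow_neg _ hA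
  have hQP : A ^ (-(1 / 2) : ℝ) * A ^ (1 / 2 : ℝ) = 1 := CFC.rpow_neg_mul_rpow _ hA
  have hS := rpow_half_mul_rpow_half
    (conj_nonneg_of_nonneg (CFC.rpow_nonneg (a := A) (y := -(1 / 2))) hB)
  rw [← rpow_neg_half_mul_rpow_neg_half hA, geometricMeanFormula]
  generalize A ^ (1 / 2 : ℝ) = P at *
  generalize A ^ (-(1 / 2) : ℝ) = Q at *
  generalize (Q * B * Q) ^ (1 / 2 : ℝ) = S at *
  calc P * S * P * (Q * Q) * (P * S * P) = P * (S * (P * Q) * (Q * P) * S) * P := by noncomm_ring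
    _ = P * (Q * B * Q) * P := by rw [hPQ, hQP, mul_one, mul_one, hS]
    _ = (P * Q) * B * (Q * P) := by simp only [mul_assoc]
    _ = B := by rw [hPQ, hQP, mul_one, one_mul]

/-- Joint monotonicity. By the Riccati equation `G A'⁻¹ G ≤ G A⁻¹ G = B ≤ B'`; conjugating by
`A'^{-1/2}` bounds the square of `A'^{-1/2} G A'^{-1/2}`, and the square root is operator monotone. -/
lemma geometricMeanFormula_mono {A B A' B' : H →L[ℂ] H} (hA : IsStrictlyPositive A) (hB : 0 ≤ B)
    (hAA' : A ≤ A') (hBB' : B ≤ B') : geometricMeanFormula A B ≤ geometricMeanFormula A' B' := by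
  have hA' : IsStrictlyPositive A' := hA.of_le hAA'
  have hG := geometricMeanFormula_nonneg A B
  have hric := geometricMeanFormula_riccati hA hB
  have hinv : A' ^ (-1 : ℝ) ≤ A ^ (-1 : ℝ) :=
    CStarAlgebra.rpow_neg_one_le_rpow_neg_one hAA' hA
  have hGinv := (conj_le_conj_of_nonneg hG hinv).trans (hric.le.trans hBB')
  have hQ : 0 ≤ A' ^ (-(1 / 2) : ℝ) := CFC.rpow_nonneg
  have hP : 0 ≤ A' ^ (1 / 2 : ℝ) := CFC.rpow_nonneg
  have hPQ : A' ^ (1 / 2 : ℝ) * A' ^ (-(1 / 2) : ℝ) = 1 := CFC.rpow_mul_rpow_neg _ hA'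
  have hQP : A' ^ (-(1 / 2) : ℝ) * A' ^ (1 / 2 : ℝ) = 1 := CFC.rpow_neg_mul_rpow _ hA'
  rw [← rpow_neg_half_mul_rpow_neg_half hA'] at hGinv
  rw [geometricMeanFormula.eq_1 A' B', ← CFC.sqrt_eq_rpow (a := _ * B' * _)]
  generalize geometricMeanFormula A B = G at *
  generalize A' ^ (1 / 2 : ℝ) = P at *
  generalize A' ^ (-(1 / 2) : ℝ) = Q at *
  have hsq : (Q * G * Q) * (Q * G * Q) ≤ Q * B' * Q := by
    refine le_trans (le_of_eq ?_) (conj_le_conj_of_nonneg hQ hGinv)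
    noncomm_ring
  have hle := CFC.sqrt_le_sqrt _ _ hsq
  rw [CFC.sqrt_mul_self _ (conj_nonneg_of_nonneg hQ hG)] at hle
  refine le_trans (le_of_eq ?_) (conj_le_conj_of_nonneg hP hle)
  calc G = (P * Q) * G * (Q * P) := by rw [hPQ, hQP, mul_one, one_mul]
    _ = P * (Q * G * Q) * P := by noncomm_ring

/-- A reverse arithmetic-geometric mean inequality. For commuting `A` and `B` it reads
`a b + s² ≤ 2 b s` for `s ∈ [a, b]`; the general case is this one for `A^{-1/2} B A^{-1/2} = S²`. -/
lemma smul_add_le_geometricMeanFormula {A B : H →L[ℂ] H} {a b : ℝ} (hA : IsStrictlyPositive A)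
    (ha : 0 ≤ a) (hab : a ≤ b) (haA : a ^ 2 • A ≤ B) (hbA : B ≤ b ^ 2 • A) :
    (a * b) • A + B ≤ (2 * b) • geometricMeanFormula A B := by
  have hb : 0 ≤ b := ha.trans hab
  have hB : 0 ≤ B := (smul_nonneg (sq_nonneg a) hA.nonneg).trans haA
  have hQ : 0 ≤ A ^ (-(1 / 2) : ℝ) := CFC.rpow_nonneg
  have hP : 0 ≤ A ^ (1 / 2 : ℝ) := CFC.rpow_nonneg
  have hPQ : A ^ (1 / 2 : ℝ) * A ^ (-(1 / 2) : ℝ) = 1 := CFC.rpow_mul_rpow_neg _ hA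
  have hQP : A ^ (-(1 / 2) : ℝ) * A ^ (1 / 2 : ℝ) = 1 := CFC.rpow_neg_mul_rpow _ hA
  have hPP : A ^ (1 / 2 : ℝ) * A ^ (1 / 2 : ℝ) = A := rpow_half_mul_rpow_half hA.nonneg
  rw [geometricMeanFormula, ← CFC.sqrt_eq_rpow (a := _ * B * _)]
  generalize A ^ (1 / 2 : ℝ) = P at *
  generalize A ^ (-(1 / 2) : ℝ) = Q at *
  have hQAQ : Q * A * Q = 1 := by
    rw [← hPP]
    calc Q * (P * P) * Q = (Q * P) * (P * Q) := by noncomm_ring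
      _ = 1 := by rw [hPQ, hQP, one_mul]
  have hSS := CFC.sqrt_mul_sqrt_self (Q * B * Q) (conj_nonneg_of_nonneg hQ hB)
  have hS := CFC.sqrt_nonneg (Q * B * Q)
  have hsq : ∀ c : ℝ, 0 ≤ c → CFC.sqrt (c ^ 2 • (1 : H →L[ℂ] H)) = c • 1 := fun c hc =>
    CFC.sqrt_unique (by rw [smul_mul_smul_comm, one_mul, sq]) (smul_nonneg hc zero_le_one)
  have hlow : a • (1 : H →L[ℂ] H) ≤ CFC.sqrt (Q * B * Q) := by
    rw [← hsq a ha]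
    refine CFC.sqrt_le_sqrt _ _ (le_trans (le_of_eq ?_) (conj_le_conj_of_nonneg hQ haA))
    rw [mul_smul_comm, smul_mul_assoc, hQAQ]
  have hupp : CFC.sqrt (Q * B * Q) ≤ b • (1 : H →L[ℂ] H) := by
    rw [← hsq b hb]
    refine CFC.sqrt_le_sqrt _ _ ((conj_le_conj_of_nonneg hQ hbA).trans (le_of_eq ?_))
    rw [mul_smul_comm, smul_mul_assoc, hQAQ]
  generalize CFC.sqrt (Q * B * Q) = S at *
  have hcomm : Commute (S - a • (1 : H →L[ℂ] H)) (b • (1 : H →L[ℂ] H) - S) := by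
    have h1 : ∀ c : ℝ, Commute (c • (1 : H →L[ℂ] H)) S := fun c => (Commute.one_left S).smul_left c
    have h2 : ∀ c d : ℝ, Commute (c • (1 : H →L[ℂ] H)) (d • (1 : H →L[ℂ] H)) := fun c d =>
      ((Commute.one_left _).smul_left c)
    exact ((h1 b).symm.sub_left (h2 a b)).sub_right ((Commute.refl S).sub_left (h1 a))
  -- `(S - a)(b - S) + (b - a) S = 2 b S - a b - S²`
  have hprod := add_nonneg (hcomm.mul_nonneg (sub_nonneg.mpr hlow) (sub_nonneg.mpr hupp))
    (smul_nonneg (sub_nonneg.mpr hab) hS)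
  have hS2 : (a * b) • (1 : H →L[ℂ] H) + Q * B * Q ≤ (2 * b) • S := by
    rw [← sub_nonneg, ← hSS]
    convert hprod using 1
    simp only [sub_mul, mul_sub, smul_mul_assoc, mul_smul_comm, one_mul, mul_one]
    module
  refine le_trans (le_of_eq ?_) ((conj_le_conj_of_nonneg hP hS2).trans (le_of_eq ?_))
  · calc (a * b) • A + B = (a * b) • (P * P) + (P * Q) * B * (Q * P) := by
          rw [hPP, hPQ, hQP, one_mul, mul_one]
      _ = _ := by
        simp only [mul_add, add_mul, mul_smul_comm, smul_mul_assoc, mul_one, mul_assoc]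
  · rw [mul_smul_comm, smul_mul_assoc]

/-! ### Strong limits of monotone families -/

open scoped InnerProductSpace in
/-- Cauchy-Schwarz for the positive form `⟨D x, y⟩`, at `y = D x`. -/
lemma norm_apply_sq_le_of_nonneg {D : H →L[ℂ] H} (hD : 0 ≤ D) (x : H) :
    ‖D x‖ ^ 2 ≤ ‖D‖ * RCLike.re ⟪D x, x⟫_ℂ := by
  have hS := CFC.sqrt_mul_sqrt_self D hD
  have hSs : IsSelfAdjoint (CFC.sqrt D) := (CFC.sqrt_nonneg D).isSelfAdjoint
  generalize CFC.sqrt D = S at *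
  have hn : ‖D‖ = ‖S‖ * ‖S‖ := by
    rw [← hS, ← CStarRing.norm_star_mul_self, hSs.star_eq]
  have hsymm : ∀ y z : H, ⟪S y, z⟫_ℂ = ⟪y, S z⟫_ℂ := hSs.isSymmetric
  have hx : RCLike.re ⟪D x, x⟫_ℂ = ‖S x‖ ^ 2 := by
    rw [← hS, mul_apply_eq_comp, hsymm (S x) x]
    exact inner_self_eq_norm_sq (S x)
  rw [hn, hx, ← hS, mul_apply_eq_comp, ← sq, ← mul_pow]
  gcongr
  exact S.le_opNorm _

/-- Vigier's theorem: a family of positive operators that decreases as `ε ↓ 0` converges strongly. -/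
lemma exists_strong_limit_of_monotoneOn {F : ℝ → H →L[ℂ] H} (hF : MonotoneOn F (Set.Ioi 0))
    (h0 : ∀ ε, 0 < ε → 0 ≤ F ε) :
    ∃ G : H →L[ℂ] H, ∀ x, Tendsto (fun ε => F ε x) (𝓝[>] 0) (𝓝 (G x)) := by
  have key : ∀ x, ∃ y, Tendsto (fun ε => F ε x) (𝓝[>] 0) (𝓝 y) := by
    intro x
    set g : ℝ → ℝ := fun ε => RCLike.re (inner ℂ (F ε x) x) with hg
    have hgmono : MonotoneOn g (Set.Ioi 0) := fun δ hδ ε hε h => by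
      have := (ContinuousLinearMap.le_def _ _).mp (hF hδ hε h) |>.re_inner_nonneg_left x
      simpa [hg, inner_sub_left] using this
    have hgb : BddBelow (g '' Set.Ioi 0) := by
      refine ⟨0, ?_⟩
      rintro _ ⟨ε, hε, rfl⟩
      exact ((ContinuousLinearMap.nonneg_iff_isPositive _).mp (h0 ε hε)).re_inner_nonneg_left x
    have hglim := hgmono.tendsto_nhdsGT hgb
    have hbound : ∀ δ ε, 0 < δ → δ ≤ ε → ε ≤ 1 →
        ‖F ε x - F δ x‖ ^ 2 ≤ ‖F 1‖ * |g ε - g δ| := by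
      intro δ ε hδ h h1
      have hε := hδ.trans_le h
      have hD : 0 ≤ F ε - F δ := sub_nonneg.mpr (hF hδ hε h)
      have h2 := norm_apply_sq_le_of_nonneg hD x
      have h3 : ‖F ε - F δ‖ ≤ ‖F 1‖ := CStarAlgebra.norm_le_norm_of_nonneg_of_le hD
        ((sub_le_self _ (h0 δ hδ)).trans (hF hε (Set.mem_Ioi.mpr one_pos) h1))
      have h4 : RCLike.re (inner ℂ ((F ε - F δ) x) x) = g ε - g δ := by
        simp [hg]
      rw [h4] at h2
      calc ‖F ε x - F δ x‖ ^ 2 ≤ ‖F ε - F δ‖ * (g ε - g δ) := h2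
        _ ≤ _ := mul_le_mul h3 (le_abs_self _) (sub_nonneg.mpr (hgmono hδ hε h)) (norm_nonneg _)
    -- `g` converges, so the bound shows that `F ε x` is Cauchy as `ε ↓ 0`.
    apply cauchy_map_iff_exists_tendsto.mp
    rw [cauchy_map_iff]
    refine ⟨inferInstance, ?_⟩
    rw [tendsto_uniformity_iff_dist_tendsto_zero]
    have hlim : Tendsto (fun p : ℝ × ℝ => √(‖F 1‖ * |g p.1 - g p.2|)) (𝓝[>] 0 ×ˢ 𝓝[>] 0)
        (𝓝 0) := by
      have := ((((hglim.comp tendsto_fst).sub (hglim.comp tendsto_snd)).abs).const_mul ‖F 1‖).sqrt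
      simpa using this
    refine tendsto_of_tendsto_of_tendsto_of_le_of_le' tendsto_const_nhds hlim
      (Eventually.of_forall fun _ => dist_nonneg) ?_
    have hI : ∀ᶠ ε : ℝ in 𝓝[>] 0, 0 < ε ∧ ε ≤ 1 := Ioc_mem_nhdsGT one_pos
    filter_upwards [hI.prod_mk hI] with p hp
    apply Real.le_sqrt_of_sq_le
    rw [dist_eq_norm]
    rcases le_total p.2 p.1 with h | h
    · exact hbound _ _ hp.2.1 h hp.1.2
    · rw [norm_sub_rev, abs_sub_comm]
      exact hbound _ _ hp.1.1 h hp.2.2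
  choose G hG using key
  exact ⟨continuousLinearMapOfTendsto F (tendsto_pi_nhds.mpr hG), hG⟩

open scoped ComplexOrder in
lemma le_of_tendsto_apply {H : Type*} [NormedAddCommGroup H] [InnerProductSpace ℂ H]
    {ι : Type*} {l : Filter ι} [l.NeBot] {F : ι → H →L[ℂ] H}
    {K G : H →L[ℂ] H} (hG : ∀ x, Tendsto (fun i => F i x) l (𝓝 (G x)))
    (hK : ∀ᶠ i in l, K ≤ F i) : K ≤ G := by
  rw [ContinuousLinearMap.le_def, ContinuousLinearMap.isPositive_iff_complex]
  intro x
  have hlim : Tendsto (fun i => inner ℂ ((F i - K) x) x) l (𝓝 (inner ℂ ((G - K) x) x)) :=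
    ((hG x).sub_const (K x)).inner tendsto_const_nhds
  have hpos : 0 ≤ inner ℂ ((G - K) x) x :=
    ge_of_tendsto hlim (hK.mono fun i hi =>
      ((ContinuousLinearMap.le_def _ _).mp hi).inner_nonneg_left x)
  exact ⟨(Complex.eq_re_of_ofReal_le hpos).symm, (Complex.nonneg_iff.mp hpos).1⟩

/-! ### The geometric mean as a strong limit -/

lemma exists_isGeometricMean {A B : H →L[ℂ] H} (hA : 0 ≤ A) (hB : 0 ≤ B) :
    ∃ G, IsGeometricMean A B G := by
  refine exists_strong_limit_of_monotoneOn (fun δ hδ ε _ h => ?_)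
    fun ε _ => geometricMeanFormula_nonneg _ _
  have hδε : δ • (1 : H →L[ℂ] H) ≤ ε • 1 := smul_le_smul_of_nonneg_right h zero_le_one
  exact geometricMeanFormula_mono (isStrictlyPositive_add_smul_one hA hδ)
    (isStrictlyPositive_add_smul_one hB hδ).nonneg (by gcongr) (by gcongr)

lemma isGeometricMean_geometricMean {A B : H →L[ℂ] H} (hA : 0 ≤ A) (hB : 0 ≤ B) :
    IsGeometricMean A B (geometricMean A B) := by
  have h := exists_isGeometricMean hA hB
  rw [geometricMean, dif_pos h]
  exact h.choose_spec

/-! ### The bound for the real part -/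

lemma smul_abs_le_abs_of_sq_le {R : Type*} [CStarAlgebra R] [PartialOrder R] [StarOrderedRing R]
    {c d : ℝ} (hc : 0 ≤ c) (hd : 0 ≤ d) {x y : R} (hx : 0 ≤ x) (hy : 0 ≤ y)
    (h : c ^ 2 • x ^ 2 ≤ d ^ 2 • y ^ 2) : c • x ≤ d • y := by
  rw [← smul_pow, ← smul_pow] at h
  have := CFC.sqrt_le_sqrt _ _ h
  rwa [CFC.sqrt_sq _ (smul_nonneg hc hx), CFC.sqrt_sq _ (smul_nonneg hd hy)] at this

/-- The main inequality, with `a = √α` and `b = √β`. The constant is `2 b / u` with `u = √(a b)`; this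
`u` makes `u |T| + u⁻¹ |T⋆|` proportional to `a b |T| + |T⋆|`. -/
lemma add_star_le_geometricMean {a b : ℝ} (ha : 0 < a) (ha1 : a ≤ 1) (hb1 : 1 ≤ b)
    (T : H →L[ℂ] H) (hlow : a ^ 2 • CFC.abs T ≤ CFC.abs (star T))
    (hupp : CFC.abs (star T) ≤ b ^ 2 • CFC.abs T) :
    T + star T ≤ (2 * √(b / a)) • geometricMean (CFC.abs T) (CFC.abs (star T)) := by
  have hA := CFC.abs_nonneg T
  have hB := CFC.abs_nonneg (star T)
  have hab : a ≤ b := ha1.trans hb1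
  have hb : 0 < b := ha.trans_le hab
  have hG := isGeometricMean_geometricMean hA hB
  refine le_of_tendsto_apply (F := fun ε : ℝ => (2 * √(b / a)) • geometricMeanFormula
    (CFC.abs T + ε • (1 : H →L[ℂ] H)) (CFC.abs (star T) + ε • (1 : H →L[ℂ] H)))
    (fun x => (hG x).const_smul _) ?_
  filter_upwards [self_mem_nhdsWithin] with ε (hε : 0 < ε)
  have hε1 : 0 ≤ ε • (1 : H →L[ℂ] H) := smul_nonneg hε.le zero_le_one
  have hu : 0 < √(a * b) := Real.sqrt_pos.mpr (mul_pos ha hb)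
  have h1 := add_star_le T hε hu
  set A := CFC.abs T
  set B := CFC.abs (star T)
  -- Since `a ≤ 1 ≤ b`, adding `ε` to both operators preserves the two-sided bound.
  have hlow' : a ^ 2 • (A + ε • (1 : H →L[ℂ] H)) ≤ B + ε • (1 : H →L[ℂ] H) := by
    rw [smul_add]
    exact add_le_add hlow (smul_le_of_le_one_left hε1 (pow_le_one₀ ha.le ha1))
  have hupp' : B + ε • (1 : H →L[ℂ] H) ≤ b ^ 2 • (A + ε • (1 : H →L[ℂ] H)) := by
    rw [smul_add]
    exact add_le_add hupp (le_smul_of_one_le_left hε1 (one_le_pow₀ hb1))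
  have h2 := smul_add_le_geometricMeanFormula (isStrictlyPositive_add_smul_one hA hε) ha.le hab
    hlow' hupp'
  have h3 := smul_le_smul_of_nonneg_left h2 (inv_nonneg.mpr hu.le)
  have hsq : √(a * b) * √(a * b) = a * b := Real.mul_self_sqrt (mul_pos ha hb).le
  have hc1 : (√(a * b))⁻¹ * (a * b) = √(a * b) := by
    rw [inv_mul_eq_iff_eq_mul₀ hu.ne', hsq]
  have hc2 : (√(a * b))⁻¹ * (2 * b) = 2 * √(b / a) := by
    rw [inv_mul_eq_iff_eq_mul₀ hu.ne', mul_left_comm, ← Real.sqrt_mul (mul_pos ha hb).le]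
    congr 1
    rw [show a * b * (b / a) = b * b by field_simp, Real.sqrt_mul_self hb.le]
  rw [smul_add, smul_smul, smul_smul, hc1, hc2] at h3
  refine h1.trans (le_trans ?_ h3)
  have : B ≤ B + ε • (1 : H →L[ℂ] H) := le_add_of_nonneg_right hε1
  have := smul_le_smul_of_nonneg_left this (inv_nonneg.mpr hu.le)
  gcongr

lemma half_smul_le_of_le_two_mul_smul {X G : H →L[ℂ] H} {c : ℝ} (h : X ≤ (2 * c) • G) :
    (2⁻¹ : ℝ) • X ≤ c • G := by
  have := smul_le_smul_of_nonneg_left h (by norm_num : (0 : ℝ) ≤ 2⁻¹)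
  rwa [smul_smul, inv_mul_cancel_left₀ two_ne_zero] at this

end Operators

theorem theorem28 {H : Type*} [NormedAddCommGroup H] [InnerProductSpace ℂ H] [CompleteSpace H]
    (α β : ℝ) (hα : 0 < α) (T : H →L[ℂ] H) (hT : IsAlphaBetaNormal α β T) :
    IsGeometricMean (CFC.abs T) (CFC.abs (star T))
        (geometricMean (CFC.abs T) (CFC.abs (star T))) ∧
      (realPart T : H →L[ℂ] H) ≤
        (β / α) ^ (1 / 4 : ℝ) • geometricMean (CFC.abs T) (CFC.abs (star T)) ∧
      -(realPart T : H →L[ℂ] H) ≤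
        (β / α) ^ (1 / 4 : ℝ) • geometricMean (CFC.abs T) (CFC.abs (star T)) := by
  have hA := CFC.abs_nonneg T
  have hB := CFC.abs_nonneg (star T)
  have hβ : 0 < β := one_pos.trans_le hT.one_le_beta
  have hlow : √α ^ 2 • CFC.abs T ≤ CFC.abs (star T) := by
    rw [Real.sq_sqrt hα.le]
    simpa using smul_abs_le_abs_of_sq_le hα.le zero_le_one hA hB (by simpa using hT.lower)
  have hupp : CFC.abs (star T) ≤ √β ^ 2 • CFC.abs T := by
    rw [Real.sq_sqrt hβ.le]
    simpa using smul_abs_le_abs_of_sq_le zero_le_one hβ.le hB hA (by simpa using hT.upper)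
  have hc : √(√β / √α) = (β / α) ^ (1 / 4 : ℝ) := by
    rw [← Real.sqrt_div hβ.le, Real.sqrt_eq_rpow, Real.sqrt_eq_rpow,
      ← Real.rpow_mul (div_pos hβ hα).le]
    norm_num
  have key := fun S : H →L[ℂ] H => add_star_le_geometricMean (Real.sqrt_pos.mpr hα)
    (Real.sqrt_le_one.mpr hT.alpha_le_one) (Real.one_le_sqrt.mpr hT.one_le_beta) S
  rw [hc] at key
  refine ⟨isGeometricMean_geometricMean hA hB, ?_, ?_⟩
  · rw [realPart_apply_coe]
    exact half_smul_le_of_le_two_mul_smul (key T hlow hupp)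
  · have hneg := key (-T)
    rw [star_neg, CFC.abs_neg, CFC.abs_neg] at hneg
    rw [realPart_apply_coe, ← smul_neg, neg_add]
    exact half_smul_le_of_le_two_mul_smul (hneg hlow hupp)
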